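/- There is an absolute constant $C>0$ such that the following holds for all integers $n\ge 2$ and $k\ge 0$. Let $H=H_{n,k}\subset\{0,1\}^n\subset\mathbb{R}^n$ be the set of all $0/1$-vectors with exactly $k$ ones, and for $x\in\mathbb{R}^n$ let $A_H(x)=(\operatorname{sign}\langle x,h\rangle)_{h\in H}\in\{-,0,+\}^H$. A linear decision tree is a ternary tree in which each inner node is labelled by a vector $q\in\mathbb{R}^n$ and has one child for each possible value of $\operatorname{sign}\langle q,x\rangle\in\{-,0,+\}$, and in which each leaf carries an output; its depth is the maximal number of queries on a path from the root to a leaf. Then there is a linear decision tree $T$ of depth at most $C\,k\,n\log^2 n$ such that: 1. $T$ is a comparison decision tree for $H$: each query $q$ of $T$ is either an element of $H$ (a query for the sign of $\sum_{i\in I}x_i$ with $|I|=k$) or a difference $h'-h''$ with $h',h''\in H$ (a comparison of $\sum_{i\in I}x_i$ with $\sum_{j\in J}x_j$, where $|I|=|J|=k$); 2. on every input $x\in\mathbb{R}^n$ the tree $T$ outputs $A_H(x)$; in particular it solves the $k$-SUM problem: there is a set $I\subseteq\{1,\dots,n\}$ with $|I|=k$ and $\sum_{i\in I}x_i=0$ if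 and only if the output of $T$ on $x$ has a $0$ entry; 3. each query of $T$ is $2k$-sparse (it has at most $2k$ nonzero coefficients) and all its coefficients lie in $\{-1,0,1\}$. -/

import Mathlib

noncomputable section

/-- A ternary linear decision tree for inputs `x ∈ ℝⁿ`, with outputs in `α` at the leaves.  An inner
node `query q child` asks for `sign ⟨q, x⟩` and continues with the subtree `child s`, where
`s ∈ {-1, 0, 1}` is the answer. -/
inductive LinearDecisionTree (n : ℕ) (α : Type*) where
  | leaf (a : α) : LinearDecisionTree n α
  | query (q : Fin n → ℝ) (child : SignType → LinearDecisionTree n α) : LinearDecisionTree n α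

namespace LinearDecisionTree

variable {n : ℕ} {α : Type*}

/-- The output of the tree on input `x`. -/
def eval (x : Fin n → ℝ) : LinearDecisionTree n α → α
  | leaf a => a
  | query q child => (child (SignType.sign (q ⬝ᵥ x))).eval x

/-- The depth of the tree: the largest number of queries on a path from the root to a leaf. -/
def depth : LinearDecisionTree n α → ℕ
  | leaf _ => 0
  | query _ child => (Finset.univ.sup fun s : SignType => (child s).depth) + 1

/-- The set of all queries at the inner nodes of the tree. -/
def queries : LinearDecisionTree n α → Set (Fin n → ℝ)
  | leaf _ => ∅
  | query q child => {q} ∪ ⋃ s : SignType, (child s).queries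

/-- A comparison decision tree for `H`: every query is a label query `sign ⟨h, x⟩` with `h ∈ H`
or a comparison query `sign ⟨h' - h'', x⟩` with `h', h'' ∈ H`. -/
def IsComparisonTree (H : Set (Fin n → ℝ)) (T : LinearDecisionTree n α) : Prop :=
  ∀ q ∈ T.queries, q ∈ H ∨ ∃ h' ∈ H, ∃ h'' ∈ H, q = h' - h''

/-- Every query of the tree has at most `s` nonzero coefficients. -/
def IsSparse (s : ℕ) (T : LinearDecisionTree n α) : Prop :=
  ∀ q ∈ T.queries, hammingNorm q ≤ s

end LinearDecisionTree

/-- The point-location function `A_H(x) = (sign ⟨x, h⟩ : h ∈ H) ∈ {-, 0, +}^H`. -/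
def pointLocation {n : ℕ} (H : Set (Fin n → ℝ)) (x : Fin n → ℝ) : H → SignType :=
  fun h => SignType.sign (x ⬝ᵥ (h : Fin n → ℝ))

/-- The vectors in `{0,1}ⁿ` of Hamming weight `k`. -/
def weightVectors (n k : ℕ) : Set (Fin n → ℝ) :=
  {h | (∀ i, h i = 0 ∨ h i = 1) ∧ hammingNorm h = k}

/-- `x` is a yes-instance of `k`-SUM: some `k` entries of `x`, at distinct positions,
have sum `0`. -/
def HasKSum {n : ℕ} (k : ℕ) (x : Fin n → ℝ) : Prop :=
  ∃ I : Finset (Fin n), I.card = k ∧ ∑ i ∈ I, x i = 0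

end

/-!
The answers to all label and comparison queries on a set `S` at `x` determine the position of `0`
among the values `⟨s, x⟩` together with their order. If `d` is a large enough multiple of
`n log n`, then by Siegel's lemma the consecutive differences of `d + 1` vectors of `{0,1}ⁿ` with
the same sign at `x`, sorted by their value at `x`, satisfy a linear relation with coefficients in
`{-1, 0, 1}`, and such a relation writes one of the vectors as the first one plus a nonnegative
combination of earlier differences. Hence at most `3 d` elements of any `S ⊆ {0,1}ⁿ` are not
inferred from the other elements of `S`.

By double counting, a sequence of `O(d)` elements of `K` in which no element is inferred from its
predecessors is then much rarer than a sequence in which each element is picked from half of `K`.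
So, when elements of `K` that are not inferred from the earlier ones are chosen well on average over
the candidate inputs `X`, after `O(d)` choices either half of the signs in `K` are known or all but
a `2^{-Ω(d)}` fraction of `X` is excluded. A chosen element is sorted into the earlier ones by
guessing the position it has at a median candidate: two queries verify the guess, and a wrong guess
halves `X`. Finitely many candidates, `exp(O(n log #H))` of them, realise all sign patterns of the
queries, so the depth is `O(d log #H + n log #H)`, and `log #H ≤ k log n`.
-/

open Finset Module

section Combinatorics

variable {α β : Type*} [LinearOrder β]

lemma exists_median {X : Finset α} (hX : X.Nonempty) (f : α → β) :
    ∃ x₀ ∈ X, 2 * #{x ∈ X | f x < f x₀} ≤ #X ∧ 2 * #{x ∈ X | f x₀ < f x} ≤ #X := by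
  obtain ⟨a, ha, hmin⟩ := X.exists_min_image f hX
  have hlow : ({x ∈ X | 2 * #{y ∈ X | f y < f x} ≤ #X}).Nonempty := by
    refine ⟨a, mem_filter.2 ⟨ha, ?_⟩⟩
    rw [filter_false_of_mem fun y hy => (hmin y hy).not_gt]
    simp
  obtain ⟨x₀, hx₀, hmax⟩ := exists_max_image _ f hlow
  obtain ⟨hx₀X, hx₀low⟩ := mem_filter.1 hx₀
  refine ⟨x₀, hx₀X, hx₀low, ?_⟩
  rcases ({x ∈ X | f x₀ < f x}).eq_empty_or_nonempty with hup | hup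
  · simp [hup]
  obtain ⟨y, hy, hymin⟩ := exists_min_image _ f hup
  obtain ⟨hyX, hx₀y⟩ := mem_filter.1 hy
  have hylow : #X < 2 * #{x ∈ X | f x < f y} := by
    by_contra! hle
    exact (hmax y (mem_filter.2 ⟨hyX, hle⟩)).not_gt hx₀y
  have hsplit : #{x ∈ X | f x < f y} ≤ #{x ∈ X | ¬ f x₀ < f x} :=
    card_le_card fun x hx => by
      obtain ⟨hxX, hxy⟩ := mem_filter.1 hx
      exact mem_filter.2 ⟨hxX, fun h => (hymin x (mem_filter.2 ⟨hxX, h⟩)).not_gt hxy⟩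
  have hcard := card_filter_add_card_filter_not (s := X) (fun x => f x₀ < f x)
  omega

lemma exists_subset_card_le_one_forall_le (A : Finset α) (f : α → β) :
    ∃ T ⊆ A, #T ≤ 1 ∧ ∀ s ∈ A, ∃ t ∈ T, f s ≤ f t := by
  rcases A.eq_empty_or_nonempty with rfl | hA
  · exact ⟨∅, subset_rfl, by simp, by simp⟩
  · obtain ⟨t, ht, hmax⟩ := A.exists_max_image f hA
    exact ⟨{t}, singleton_subset_iff.2 ht, by simp, fun s hs =>
      ⟨t, mem_singleton_self t, hmax s hs⟩⟩

lemma exists_monotone_enumeration {N : Finset α} {d : ℕ} (hd : d < #N) (f : α → β) :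
    ∃ h : ℕ → α, (∀ i, h i ∈ N) ∧ Monotone (f ∘ h) ∧ Set.InjOn h (Set.Iic d) := by
  obtain ⟨N', hN', hcard⟩ := exists_subset_card_eq (Nat.succ_le_of_lt hd)
  let e : Fin (d + 1) ≃ N' := (N'.equivFinOfCardEq hcard).symm
  let σ := Tuple.sort fun i => f (e i)
  let trunc : ℕ → Fin (d + 1) := fun i => ⟨min i d, by omega⟩
  have htrunc : Monotone trunc := fun i j hij => Fin.mk_le_mk.2 (min_le_min_right d hij)
  refine ⟨fun i => e (σ (trunc i)), fun i => hN' (e _).2,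
    (Tuple.monotone_sort fun i => f (e i)).comp htrunc, fun i hi j hj hij => ?_⟩
  have := Fin.mk.inj (σ.injective (e.injective (Subtype.ext hij)))
  rwa [min_eq_left hi, min_eq_left hj] at this

lemma exists_mul_le_two_mul_sum {U : Finset α} {k : ℕ} (hk : k < 2 * #U) (F : α → ℕ) :
    ∃ u ∈ U, k * F u ≤ 2 * ∑ v ∈ U, F v := by
  obtain ⟨u, hu, hmin⟩ := U.exists_min_image F (card_pos.1 (by omega))
  refine ⟨u, hu, ?_⟩
  calc k * F u ≤ 2 * #U * F u := Nat.mul_le_mul_right _ hk.le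
    _ = 2 * (#U • F u) := by rw [smul_eq_mul, mul_assoc]
    _ ≤ 2 * ∑ v ∈ U, F v := Nat.mul_le_mul_left _ (card_nsmul_le_sum _ _ _ hmin)

end Combinatorics

section Chains

variable {α : Type*} [DecidableEq α]

lemma sum_powersetCard_sum_sdiff {M : Type*} [AddCommMonoid M] (K : Finset α) (j : ℕ)
    (g : Finset α → α → M) :
    ∑ S ∈ K.powersetCard j, ∑ u ∈ K \ S, g S u =
      ∑ T ∈ K.powersetCard (j + 1), ∑ u ∈ T, g (T.erase u) u := by
  rw [sum_sigma', sum_sigma']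
  refine sum_bij' (fun a _ => ⟨insert a.2 a.1, a.2⟩) (fun a _ => ⟨a.1.erase a.2, a.2⟩)
    ?_ ?_ ?_ ?_ ?_ <;> rintro ⟨S, u⟩ h <;>
    simp only [mem_sigma, mem_powersetCard, mem_sdiff] at h ⊢ <;>
    obtain ⟨⟨hSK, hcard⟩, hu⟩ := h
  · refine ⟨⟨insert_subset hu.1 hSK, ?_⟩, mem_insert_self u S⟩
    rw [card_insert_of_notMem hu.2, hcard]
  · refine ⟨⟨(erase_subset u S).trans hSK, ?_⟩, hSK hu, notMem_erase u S⟩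
    rw [card_erase_of_mem hu, hcard, Nat.add_sub_cancel]
  · rw [erase_insert hu.2]
  · rw [insert_erase hu]
  · rw [erase_insert hu.2]

open scoped Classical in
/-- The number of sequences `u₁, …, u_r` in `K` such that each `u_i` is independent, in the sense of
the relation `P`, of the set `S ∪ {u₁, …, u_{i-1}}` of its predecessors. -/
noncomputable def chainCount (P : Finset α → α → Prop) (K : Finset α) : ℕ → Finset α → ℕ
  | 0, _ => 1
  | r + 1, S => ∑ u ∈ K with P S u, chainCount P K r (insert u S)

variable {P : Finset α → α → Prop} {K : Finset α} {d : ℕ}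

open scoped Classical in
lemma sum_chainCount_succ_le (hP : ∀ S, ∀ u ∈ S, ¬ P S u)
    (hd : ∀ S ⊆ K, #{u ∈ S | P (S.erase u) u} ≤ d) (j r : ℕ) :
    ∑ S ∈ K.powersetCard j, chainCount P K (r + 1) S ≤
      d * ∑ T ∈ K.powersetCard (j + 1), chainCount P K r T := by
  calc ∑ S ∈ K.powersetCard j, chainCount P K (r + 1) S
      = ∑ S ∈ K.powersetCard j, ∑ u ∈ K \ S,
          if P S u then chainCount P K r (insert u S) else 0 := by
        refine sum_congr rfl fun S _ => ?_
        rw [chainCount, sum_filter]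
        refine (sum_subset sdiff_subset fun u huK hu => if_neg (hP S u ?_)).symm
        simpa [huK] using hu
    _ = ∑ T ∈ K.powersetCard (j + 1), ∑ u ∈ T,
          if P (T.erase u) u then chainCount P K r (insert u (T.erase u)) else 0 :=
        sum_powersetCard_sum_sdiff K j _
    _ = ∑ T ∈ K.powersetCard (j + 1), #{u ∈ T | P (T.erase u) u} * chainCount P K r T := by
        refine sum_congr rfl fun T _ => ?_
        rw [← sum_filter, ← smul_eq_mul, ← sum_const]
        exact sum_congr rfl fun u hu => by rw [insert_erase (mem_filter.1 hu).1]
    _ ≤ d * ∑ T ∈ K.powersetCard (j + 1), chainCount P K r T := by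
        rw [mul_sum]
        exact sum_le_sum fun T hT => Nat.mul_le_mul_right _ (hd T (mem_powersetCard.1 hT).1)

open scoped Classical in
lemma sum_chainCount_le (hP : ∀ S, ∀ u ∈ S, ¬ P S u)
    (hd : ∀ S ⊆ K, #{u ∈ S | P (S.erase u) u} ≤ d) (j r : ℕ) :
    ∑ S ∈ K.powersetCard j, chainCount P K r S ≤ d ^ r * (#K).choose (j + r) := by
  induction r generalizing j with
  | zero => simp [chainCount]
  | succ r ih =>
    calc ∑ S ∈ K.powersetCard j, chainCount P K (r + 1) S
        ≤ d * ∑ T ∈ K.powersetCard (j + 1), chainCount P K r T := sum_chainCount_succ_le hP hd j r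
      _ ≤ d * (d ^ r * (#K).choose (j + 1 + r)) := Nat.mul_le_mul_left _ (ih (j + 1))
      _ = d ^ (r + 1) * (#K).choose (j + (r + 1)) := by rw [add_right_comm, add_assoc]; ring

lemma four_mul_pow_le_factorial (d : ℕ) : (4 * d) ^ (12 * d) ≤ (12 * d).factorial := by
  let m := 12 * d
  have hexp : (m : ℝ) ^ m ≤ 3 ^ m * m.factorial := by
    have h := Real.pow_div_factorial_le_exp (m : ℝ) m.cast_nonneg m
    rw [div_le_iff₀ (by positivity), ← mul_one (m : ℝ), Real.exp_nat_mul, mul_one] at h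
    exact h.trans (by gcongr; linarith [Real.exp_one_lt_d9])
  have hpow : 3 ^ m * (4 * d) ^ m ≤ 3 ^ m * m.factorial := by
    rw [← mul_pow, show 3 * (4 * d) = m by omega]
    exact_mod_cast hexp
  exact Nat.le_of_mul_le_mul_left hpow (by positivity)

open scoped Classical in
lemma chainCount_empty_mul_four_pow_le (hP : ∀ S, ∀ u ∈ S, ¬ P S u)
    (hd : ∀ S ⊆ K, #{u ∈ S | P (S.erase u) u} ≤ d) (hd₀ : 0 < d) :
    chainCount P K (12 * d) ∅ * 4 ^ (12 * d) ≤ #K ^ (12 * d) := by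
  set m := 12 * d
  have hchoose : chainCount P K m ∅ ≤ d ^ m * (#K).choose m := by
    simpa using sum_chainCount_le hP hd 0 m
  refine Nat.le_of_mul_le_mul_right (c := d ^ m) ?_ (by positivity)
  calc chainCount P K m ∅ * 4 ^ m * d ^ m = (4 * d) ^ m * chainCount P K m ∅ := by
        rw [mul_pow]; ring
    _ ≤ m.factorial * (d ^ m * (#K).choose m) :=
        Nat.mul_le_mul (four_mul_pow_le_factorial d) hchoose
    _ = (#K).descFactorial m * d ^ m := by
        rw [Nat.descFactorial_eq_factorial_mul_choose]; ring
    _ ≤ #K ^ m * d ^ m := Nat.mul_le_mul_right _ (Nat.descFactorial_le_pow _ _)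

end Chains

section SignPatterns

open SignType (sign)

variable {𝕜 : Type*} [Field 𝕜] [LinearOrder 𝕜] [IsStrictOrderedRing 𝕜]

lemma sign_mul_add_mul {a b u v : 𝕜} (ha : 0 ≤ a) (hb : 0 ≤ b) (hab : 0 < a + b)
    (huv : sign u = sign v) : sign (a * u + b * v) = sign v := by
  rcases lt_trichotomy v 0 with hv | rfl | hv
  · have hu : u < 0 := sign_eq_neg_one_iff.1 (huv.trans (sign_neg hv))
    rw [sign_neg hv, sign_neg]
    rcases ha.eq_or_lt with rfl | ha <;> nlinarith
  · rw [sign_zero, sign_eq_zero_iff] at huv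
    simp [huv]
  · have hu : 0 < u := sign_eq_one_iff.1 (huv.trans (sign_pos hv))
    rw [sign_pos hv, sign_pos]
    rcases ha.eq_or_lt with rfl | ha <;> nlinarith

variable {V : Type*} [AddCommGroup V] [Module 𝕜 V]

lemma exists_mem_ker_sign_eq {ι : Type*} {Q : Finset ι} {f : ι → Dual 𝕜 V} {g : Dual 𝕜 V} {x y : V}
    (hxy : ∀ i ∈ Q, sign (f i x) = sign (f i y)) (hg : sign (g x) ≠ sign (g y)) :
    ∃ w ∈ g.ker, ∀ i ∈ Q, sign (f i w) = sign (f i y) := by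
  refine ⟨|g y| • x + |g x| • y, ?_, fun i hi => ?_⟩
  · rw [LinearMap.mem_ker]
    rcases lt_trichotomy (g x) 0 with hx | hx | hx <;>
      rcases lt_trichotomy (g y) 0 with hy | hy | hy <;>
      simp_all [abs_of_pos, abs_of_neg, mul_comm]
  · have hpos : 0 < |g y| + |g x| := by
      by_contra! h
      have hx : g x = 0 := by simpa using (by linarith [abs_nonneg (g y)] : |g x| ≤ 0)
      have hy : g y = 0 := by simpa using (by linarith [abs_nonneg (g x)] : |g y| ≤ 0)
      exact hg (by rw [hx, hy])
    simpa using sign_mul_add_mul (abs_nonneg _) (abs_nonneg _) hpos (hxy i hi)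

lemma exists_sign_representatives_insert {ι : Type*} [DecidableEq ι] {Q : Finset ι}
    {f : ι → Dual 𝕜 V} {j : ι} {X : Finset V} {X₀ : Finset (f j).ker}
    (hX : ∀ y, ∃ x ∈ X, ∀ i ∈ Q, sign (f i x) = sign (f i y))
    (hX₀ : ∀ y : (f j).ker, ∃ x ∈ X₀, ∀ i ∈ Q, sign (f i x) = sign (f i y)) :
    ∃ X' : Finset V, #X' ≤ #X + 3 * #X₀ ∧
      ∀ y, ∃ x ∈ X', ∀ i ∈ insert j Q, sign (f i x) = sign (f i y) := by
  classical
  have hp : ∀ (z : (f j).ker) (σ : SignType), ∃ p : V,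
      (∃ y, sign (f j y) = σ ∧ ∀ i ∈ Q, sign (f i z) = sign (f i y)) →
        sign (f j p) = σ ∧ ∀ i ∈ Q, sign (f i z) = sign (f i p) := fun z σ =>
    if h : ∃ y, sign (f j y) = σ ∧ ∀ i ∈ Q, sign (f i z) = sign (f i y)
    then h.imp fun _ hy _ => hy else ⟨0, fun h' => (h h').elim⟩
  choose p hp using hp
  refine ⟨X ∪ image₂ p X₀ univ, ?_, fun y => ?_⟩
  · calc #(X ∪ image₂ p X₀ univ) ≤ #X + #X₀ * #(univ : Finset SignType) :=
          (card_union_le _ _).trans (Nat.add_le_add_left (card_image₂_le _ _ _) _)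
      _ = #X + 3 * #X₀ := by rw [mul_comm]; rfl
  obtain ⟨x, hx, hxy⟩ := hX y
  by_cases hg : sign (f j x) = sign (f j y)
  · exact ⟨x, mem_union_left _ hx, forall_mem_insert _ _ _ |>.2 ⟨hg, hxy⟩⟩
  · obtain ⟨w, hw, hwy⟩ := exists_mem_ker_sign_eq hxy hg
    obtain ⟨z, hz, hzw⟩ := hX₀ ⟨w, hw⟩
    have hzy : ∀ i ∈ Q, sign (f i z) = sign (f i y) := fun i hi => (hzw i hi).trans (hwy i hi)
    obtain ⟨hpj, hpQ⟩ := hp z (sign (f j y)) ⟨y, rfl, hzy⟩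
    exact ⟨p z (sign (f j y)), mem_union_right _ (mem_image₂_of_mem hz (mem_univ _)),
      forall_mem_insert _ _ _ |>.2 ⟨hpj, fun i hi => (hpQ i hi).symm.trans (hzy i hi)⟩⟩

theorem exists_sign_representatives [FiniteDimensional 𝕜 V] {ι : Type*} (Q : Finset ι)
    (f : ι → Dual 𝕜 V) :
    ∃ X : Finset V, #X ≤ (3 * #Q + 1) ^ finrank 𝕜 V ∧
      ∀ y, ∃ x ∈ X, ∀ i ∈ Q, sign (f i x) = sign (f i y) := by
  classical
  induction Q using Finset.induction_on generalizing V with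
  | empty => exact ⟨{0}, by simp, by simp⟩
  | insert j Q hj ih =>
    obtain ⟨X, hcard, hX⟩ := ih f
    rw [card_insert_of_notMem hj]
    rcases eq_or_ne (f j) 0 with hf | hf
    · refine ⟨X, hcard.trans (by gcongr; omega), fun y => ?_⟩
      obtain ⟨x, hx, hxy⟩ := hX y
      exact ⟨x, hx, forall_mem_insert _ _ _ |>.2 ⟨by simp [hf], hxy⟩⟩
    obtain ⟨X₀, hcard₀, hX₀⟩ := ih fun i => (f i).domRestrict (f j).ker
    obtain ⟨X', hcard', hX'⟩ := exists_sign_representatives_insert hX hX₀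
    refine ⟨X', ?_, hX'⟩
    rw [← Dual.finrank_ker_add_one_of_ne_zero hf] at hcard ⊢
    calc #X' ≤ #X + 3 * #X₀ := hcard'
      _ ≤ (3 * #Q + 1) ^ (finrank 𝕜 (f j).ker + 1) + 3 * (3 * #Q + 1) ^ finrank 𝕜 (f j).ker := by
          gcongr
      _ = (3 * (#Q + 1) + 1) * (3 * #Q + 1) ^ finrank 𝕜 (f j).ker := by ring
      _ ≤ (3 * (#Q + 1) + 1) * (3 * (#Q + 1) + 1) ^ finrank 𝕜 (f j).ker := by gcongr; omega
      _ = (3 * (#Q + 1) + 1) ^ (finrank 𝕜 (f j).ker + 1) := by rw [pow_succ']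

end SignPatterns

section SmallRelations

open scoped Matrix

attribute [local instance] Matrix.seminormedAddCommGroup

lemma exists_abs_le_one_mulVec_eq_zero {ι κ : Type*} [Fintype ι] [Fintype κ] [Nonempty κ] {B : ℕ}
    (hB : 0 < B) {A : Matrix ι κ ℤ} (hA : ∀ i j, |A i j| ≤ B)
    (hcard : (2 * Fintype.card κ * B) ^ Fintype.card ι < 2 ^ Fintype.card κ) :
    ∃ c : κ → ℤ, c ≠ 0 ∧ (∀ i, |c i| ≤ 1) ∧ A *ᵥ c = 0 := by
  rcases isEmpty_or_nonempty ι with hι | hι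
  · exact ⟨1, one_ne_zero, by simp, funext isEmptyElim⟩
  set m := Fintype.card ι
  set n := Fintype.card κ
  have hn : 0 < n := Fintype.card_pos
  have hmn : m < n := (Nat.pow_lt_pow_iff_right one_lt_two).1 <|
    (Nat.pow_le_pow_left (by nlinarith) m).trans_lt hcard
  obtain ⟨c, hc, hAc, hnorm⟩ :=
    Int.Matrix.exists_ne_zero_int_vec_norm_le A hmn Fintype.card_pos
  have hAB : max 1 ‖A‖ ≤ B := max_le (by exact_mod_cast hB) <|
    (Matrix.norm_le_iff B.cast_nonneg).2 fun i j => by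
      rw [Int.norm_eq_abs]; exact_mod_cast hA i j
  have hexp : (0 : ℝ) < n - m := sub_pos.2 (by exact_mod_cast hmn)
  have hpow : ((n : ℝ) * max 1 ‖A‖) ^ (m : ℝ) < 2 ^ ((n : ℝ) - m) := by
    rw [Real.rpow_sub two_pos, lt_div_iff₀ (by positivity), Real.rpow_natCast, Real.rpow_natCast,
      Real.rpow_natCast, ← mul_pow]
    calc ((n : ℝ) * max 1 ‖A‖ * 2) ^ m ≤ (n * B * 2) ^ m := by gcongr
      _ = (2 * n * B) ^ m := by ring
      _ < 2 ^ n := by exact_mod_cast hcard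
  have hlt : ‖c‖ < 2 := by
    refine hnorm.trans_lt ?_
    rwa [← Real.rpow_lt_rpow_iff (by positivity) two_pos.le hexp, ← Real.rpow_mul (by positivity),
      div_mul_cancel₀ _ hexp.ne']
  refine ⟨c, hc, fun i => ?_, hAc⟩
  have hci : ‖c i‖ < 2 := (norm_le_pi_norm c i).trans_lt hlt
  rw [Int.norm_eq_abs] at hci
  exact Int.lt_add_one_iff.1 (by exact_mod_cast hci)

lemma exists_eq_sum_smul_of_sum_smul_eq_zero {E : Type*} [AddCommGroup E] {d : ℕ} {c : ℕ → ℤ}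
    {v : ℕ → E} (hc : ∃ i < d, c i ≠ 0) (hc1 : ∀ i, |c i| ≤ 1)
    (hsum : ∑ i ∈ range d, c i • v i = 0) :
    ∃ p < d, ∃ a : ℕ → ℤ, (∀ i, |a i| ≤ 1) ∧ v p = ∑ i ∈ range p, a i • v i := by
  induction d with
  | zero => simp at hc
  | succ d ih =>
    rw [sum_range_succ] at hsum
    by_cases hcd : c d = 0
    · obtain ⟨i, hi, hci⟩ := hc
      have hid : i ≠ d := by rintro rfl; exact hci hcd
      obtain ⟨p, hp, hrel⟩ := ih ⟨i, by omega, hci⟩ (by simpa [hcd] using hsum)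
      exact ⟨p, by omega, hrel⟩
    · have hsq : c d * c d = 1 := by
        rw [← abs_mul_abs_self, le_antisymm (hc1 d) (Int.one_le_abs hcd), one_mul]
      refine ⟨d, by omega, fun i => -(c d * c i), fun i => ?_, ?_⟩
      · rw [abs_neg, abs_mul]
        exact mul_le_one₀ (hc1 d) (abs_nonneg _) (hc1 i)
      · simp only [neg_smul, mul_smul, sum_neg_distrib, ← smul_sum]
        rw [eq_neg_of_add_eq_zero_left hsum, smul_neg, neg_neg, smul_smul, hsq, one_smul]

lemma exists_eq_sum_smul_of_pow_lt {ι : Type*} [Fintype ι] {B d : ℕ} (hB : 0 < B) (hd₀ : 0 < d)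
    (hd : (2 * d * B) ^ Fintype.card ι < 2 ^ d) {v : ℕ → ι → ℤ} (hv : ∀ i j, |v i j| ≤ B) :
    ∃ p < d, ∃ a : ℕ → ℤ, (∀ i, |a i| ≤ 1) ∧ v p = ∑ i ∈ range p, a i • v i := by
  have : NeZero d := ⟨hd₀.ne'⟩
  obtain ⟨c, hc, hc1, hsum⟩ := exists_abs_le_one_mulVec_eq_zero hB
    (A := Matrix.of fun j (i : Fin d) => v i j) (fun j i => hv i j) (by simpa using hd)
  obtain ⟨i, hi⟩ := Function.ne_iff.1 hc
  refine exists_eq_sum_smul_of_sum_smul_eq_zero (c := fun i => c (Fin.ofNat d i))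
    ⟨i, i.2, by simpa using hi⟩ (fun i => hc1 _) (funext fun j => ?_)
  simpa [sum_range, Matrix.mulVec, dotProduct, mul_comm] using congrFun hsum j

end SmallRelations

section Inference

open SignType (sign)

variable {ι : Type*} [Fintype ι]

/-- The points `x` and `y` give the same answers to all label queries `s` and comparison queries
`s - t` with `s, t ∈ S`. Adding `0` to `S` turns the label queries into comparisons. -/
def SameOrder (S : Finset (ι → ℝ)) (x y : ι → ℝ) : Prop :=
  ∀ s ∈ insert 0 S, ∀ t ∈ insert 0 S, sign ((s - t) ⬝ᵥ x) = sign ((s - t) ⬝ᵥ y)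

/-- The answers at `x` to the label and comparison queries on `S` determine the sign of `h` at `x`:
this is the inference relation of Kane, Lovett and Moran. -/
def Infers (S : Finset (ι → ℝ)) (x h : ι → ℝ) : Prop :=
  ∀ y, SameOrder S x y → sign (h ⬝ᵥ y) = sign (h ⬝ᵥ x)

/-- Any two vectors of `N` differ by an integer vector with entries of absolute value at most
`B`. -/
def HasBoundedIntDiffs (B : ℕ) (N : Set (ι → ℝ)) : Prop :=
  ∀ g ∈ N, ∀ h ∈ N, ∀ j, ∃ z : ℤ, |z| ≤ B ∧ (z : ℝ) = g j - h j

variable {S N : Finset (ι → ℝ)} {x y z h s t u : ι → ℝ} {B d : ℕ}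

lemma SameOrder.symm (hxy : SameOrder S x y) : SameOrder S y x :=
  fun s hs t ht => (hxy s hs t ht).symm

lemma SameOrder.trans (hxy : SameOrder S x y) (hyz : SameOrder S y z) : SameOrder S x z :=
  fun s hs t ht => (hxy s hs t ht).trans (hyz s hs t ht)

lemma SameOrder.neg (hxy : SameOrder S x y) : SameOrder S (-x) (-y) := fun s hs t ht => by
  rw [dotProduct_neg, dotProduct_neg, Left.sign_neg, Left.sign_neg, hxy s hs t ht]

lemma SameOrder.sign_eq (hxy : SameOrder S x y) (hs : s ∈ S) : sign (s ⬝ᵥ x) = sign (s ⬝ᵥ y) := by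
  simpa using hxy s (mem_insert_of_mem hs) 0 (mem_insert_self _ _)

lemma SameOrder.dotProduct_le (hxy : SameOrder S x y) (hs : s ∈ insert 0 S) (ht : t ∈ insert 0 S)
    (hst : s ⬝ᵥ x ≤ t ⬝ᵥ x) : s ⬝ᵥ y ≤ t ⬝ᵥ y := by
  rwa [← sub_nonneg, ← sub_dotProduct, ← sign_nonneg_iff, hxy t ht s hs, sign_nonneg_iff,
    sub_dotProduct, sub_nonneg] at hst

lemma Infers.congr (hxy : SameOrder S x y) (hi : Infers S x h) : Infers S y h :=
  fun z hz => (hi z (hxy.trans hz)).trans (hi y hxy).symm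

lemma infers_of_mem (hh : h ∈ S) : Infers S x h := fun _ hy => (hy.sign_eq hh).symm

lemma Infers.of_neg (hi : Infers S (-x) h) : Infers S x h := fun y hy => by
  have := hi (-y) hy.neg
  rwa [dotProduct_neg, dotProduct_neg, Left.sign_neg, Left.sign_neg, neg_inj] at this

lemma infers_of_eq_add_sum {h : ℕ → ι → ℝ} {p : ℕ} {b : ℕ → ℝ} (hb : ∀ i, 0 ≤ b i)
    (hrel : h (p + 1) = h 0 + ∑ i ∈ range p, b i • (h (i + 1) - h i)) (hS : ∀ i ≤ p, h i ∈ S)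
    (hmono : Monotone fun i => h i ⬝ᵥ x) (hcls : (∀ i, 0 < h i ⬝ᵥ x) ∨ ∀ i, h i ⬝ᵥ x = 0) :
    Infers S x (h (p + 1)) := by
  intro y hxy
  have hval : h (p + 1) ⬝ᵥ y = h 0 ⬝ᵥ y + ∑ i ∈ range p, b i * (h (i + 1) ⬝ᵥ y - h i ⬝ᵥ y) := by
    rw [hrel, add_dotProduct, sum_dotProduct]
    simp only [smul_dotProduct, sub_dotProduct, smul_eq_mul]
  have hsign₀ : sign (h 0 ⬝ᵥ x) = sign (h 0 ⬝ᵥ y) := hxy.sign_eq (hS 0 p.zero_le)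
  rcases hcls with hpos | hzero
  · rw [sign_pos (hpos _), sign_eq_one_iff, hval]
    refine add_pos_of_pos_of_nonneg ?_ (sum_nonneg fun i hi => mul_nonneg (hb i) (sub_nonneg.2 ?_))
    · rwa [sign_pos (hpos 0), eq_comm, sign_eq_one_iff] at hsign₀
    · have hi := mem_range.1 hi
      exact hxy.dotProduct_le (mem_insert_of_mem (hS i hi.le)) (mem_insert_of_mem (hS (i + 1) hi))
        (hmono i.le_succ)
  · have hvanish : ∀ i ≤ p, h i ⬝ᵥ y = 0 := fun i hi => by
      rw [← sign_eq_zero_iff, ← hxy.sign_eq (hS i hi), hzero, sign_zero]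
    rw [hzero, hval, hvanish 0 p.zero_le, zero_add, sum_eq_zero fun i hi => ?_]
    have hi := mem_range.1 hi
    rw [hvanish i hi.le, hvanish (i + 1) hi, sub_zero, mul_zero]

lemma exists_infers_of_monotone (hB : 0 < B) (hd₀ : 0 < d)
    (hd : (2 * d * B) ^ Fintype.card ι < 2 ^ d) {h : ℕ → ι → ℝ}
    (hdiff : HasBoundedIntDiffs B (Set.range h)) (hmono : Monotone fun i => h i ⬝ᵥ x)
    (hcls : (∀ i, 0 < h i ⬝ᵥ x) ∨ ∀ i, h i ⬝ᵥ x = 0) :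
    ∃ p < d, ∀ S : Finset (ι → ℝ), (∀ i ≤ p, h i ∈ S) → Infers S x (h (p + 1)) := by
  choose v hvB hv using fun i j => hdiff _ ⟨i + 1, rfl⟩ _ ⟨i, rfl⟩ j
  obtain ⟨p, hp, a, ha, hrel⟩ := exists_eq_sum_smul_of_pow_lt hB hd₀ hd hvB
  have hrel' : h (p + 1) - h p = ∑ i ∈ range p, (a i : ℝ) • (h (i + 1) - h i) := by
    funext j
    have := congrArg (Int.cast : ℤ → ℝ) (congrFun hrel j)
    simpa [hv] using this
  -- Adding the telescoping sum `h p - h 0` raises the coefficients `a i ≥ -1` to `1 + a i ≥ 0`.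
  refine ⟨p, hp, fun S hS => infers_of_eq_add_sum (b := fun i => 1 + a i) (fun i => ?_) ?_ hS
    hmono hcls⟩
  · exact_mod_cast neg_le_iff_add_nonneg'.1 (neg_le_of_abs_le (ha i))
  · simp only [add_smul, one_smul, sum_add_distrib, sum_range_sub, ← hrel']
    abel

lemma card_le_of_forall_not_infers (hB : 0 < B) (hd₀ : 0 < d)
    (hd : (2 * d * B) ^ Fintype.card ι < 2 ^ d) (hdiff : HasBoundedIntDiffs B (N : Set (ι → ℝ)))
    (hNS : N ⊆ S) (hN : ∀ h ∈ N, ¬ Infers (S.erase h) x h)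
    (hcls : (∀ h ∈ N, 0 < h ⬝ᵥ x) ∨ ∀ h ∈ N, h ⬝ᵥ x = 0) : #N ≤ d := by
  by_contra! hlt
  obtain ⟨h, hmem, hmono, hinj⟩ := exists_monotone_enumeration hlt (· ⬝ᵥ x)
  have hdiff' : HasBoundedIntDiffs B (Set.range h) := by
    rintro _ ⟨i, rfl⟩ _ ⟨j, rfl⟩
    exact hdiff _ (hmem i) _ (hmem j)
  obtain ⟨p, hp, hinf⟩ := exists_infers_of_monotone hB hd₀ hd hdiff' hmono
    (hcls.imp (fun H i => H _ (hmem i)) fun H i => H _ (hmem i))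
  refine hN _ (hmem (p + 1)) (hinf _ fun i hi => mem_erase.2 ⟨fun heq => ?_, hNS (hmem i)⟩)
  have := hinj (Set.mem_Iic.2 (by omega)) (Set.mem_Iic.2 hp) heq
  omega

open scoped Classical in
theorem card_filter_not_infers_le (hB : 0 < B) (hd₀ : 0 < d)
    (hd : (2 * d * B) ^ Fintype.card ι < 2 ^ d) (hdiff : HasBoundedIntDiffs B (S : Set (ι → ℝ)))
    (x : ι → ℝ) : #{h ∈ S | ¬ Infers (S.erase h) x h} ≤ 3 * d := by
  rw [mul_comm]
  refine card_le_mul_card_image_of_maps_to (f := fun h => sign (h ⬝ᵥ x))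
    (t := univ) (fun _ _ => mem_univ _) d fun σ _ => ?_
  have hsub : {h ∈ {h ∈ S | ¬ Infers (S.erase h) x h} | sign (h ⬝ᵥ x) = σ} ⊆ S :=
    (filter_subset _ _).trans (filter_subset _ _)
  have hdiff' := fun g hg h hh => hdiff g (hsub hg) h (hsub hh)
  rcases σ.trichotomy with rfl | rfl | rfl
  · refine card_le_of_forall_not_infers (x := -x) hB hd₀ hd hdiff' hsub
      (fun h hh hi => (mem_filter.1 (mem_filter.1 hh).1).2 hi.of_neg) (.inl fun h hh => ?_)
    rw [dotProduct_neg, neg_pos]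
    exact sign_eq_neg_one_iff.1 (mem_filter.1 hh).2
  · exact card_le_of_forall_not_infers hB hd₀ hd hdiff' hsub
      (fun h hh => (mem_filter.1 (mem_filter.1 hh).1).2)
      (.inr fun h hh => sign_eq_zero_iff.1 (mem_filter.1 hh).2)
  · exact card_le_of_forall_not_infers hB hd₀ hd hdiff' hsub
      (fun h hh => (mem_filter.1 (mem_filter.1 hh).1).2)
      (.inl fun h hh => sign_eq_one_iff.1 (mem_filter.1 hh).2)

lemma SameOrder.insert_of_forall (hxy : SameOrder S x y)
    (hu : ∀ s ∈ insert 0 S, sign ((u - s) ⬝ᵥ x) = sign ((u - s) ⬝ᵥ y)) :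
    SameOrder (insert u S) x y := by
  intro s hs t ht
  rw [insert_comm, mem_insert] at hs ht
  rcases hs with rfl | hs <;> rcases ht with rfl | ht
  · simp
  · exact hu t ht
  · rw [← neg_sub t s, neg_dotProduct, neg_dotProduct, Left.sign_neg, Left.sign_neg, hu s hs]
  · exact hxy s hs t ht

lemma SameOrder.sign_sub_le_sign_sub (hxy : SameOrder S x y) (ht : t ∈ insert 0 S)
    (hux : u ⬝ᵥ x ≤ t ⬝ᵥ x) (huy : t ⬝ᵥ y ≤ u ⬝ᵥ y) (hs : s ∈ insert 0 S) :
    sign ((u - s) ⬝ᵥ x) ≤ sign ((u - s) ⬝ᵥ y) := by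
  calc sign ((u - s) ⬝ᵥ x) ≤ sign ((t - s) ⬝ᵥ x) :=
        sign.monotone (by simpa only [sub_dotProduct, sub_le_sub_iff_right])
    _ = sign ((t - s) ⬝ᵥ y) := hxy t ht s hs
    _ ≤ sign ((u - s) ⬝ᵥ y) :=
        sign.monotone (by simpa only [sub_dotProduct, sub_le_sub_iff_right])

lemma SameOrder.sign_sub_eq_of_le (hxy : SameOrder S x y) (hs : s ∈ insert 0 S)
    (ht : t ∈ insert 0 S) (hst : s ⬝ᵥ x ≤ t ⬝ᵥ x) (htu : t ⬝ᵥ x ≤ u ⬝ᵥ x)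
    (hsign : sign ((u - t) ⬝ᵥ x) = sign ((u - t) ⬝ᵥ y)) :
    sign ((u - s) ⬝ᵥ x) = sign ((u - s) ⬝ᵥ y) := by
  have hsty := hxy.dotProduct_le hs ht hst
  rw [sub_dotProduct, sub_dotProduct] at hsign
  rcases htu.eq_or_lt with heq | hlt
  · rw [heq, sub_self, sign_zero, eq_comm, sign_eq_zero_iff, sub_eq_zero] at hsign
    exact le_antisymm (hxy.sign_sub_le_sign_sub ht heq.ge hsign.ge hs)
      (hxy.symm.sign_sub_le_sign_sub ht hsign.le heq.le hs)
  · rw [sign_pos (sub_pos.2 hlt), eq_comm, sign_eq_one_iff, sub_pos] at hsign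
    rw [sub_dotProduct, sub_dotProduct, sign_pos (sub_pos.2 (hst.trans_lt hlt)),
      sign_pos (sub_pos.2 (hsty.trans_lt hsign))]

lemma SameOrder.sum_sign_sub_lt_sum_sign_sub (hxy : SameOrder S x y) (ht : t ∈ insert 0 S)
    (hlt : sign ((u - t) ⬝ᵥ x) < sign ((u - t) ⬝ᵥ y)) :
    ∑ s ∈ insert 0 S, (sign ((u - s) ⬝ᵥ x) : ℤ) < ∑ s ∈ insert 0 S, (sign ((u - s) ⬝ᵥ y) : ℤ) := by
  have hcast : StrictMono ((↑) : SignType → ℤ) := by decide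
  have hux : u ⬝ᵥ x ≤ t ⬝ᵥ x := by
    rw [← sub_nonpos, ← sub_dotProduct, ← sign_nonpos_iff]
    exact SignType.lt_one_iff.1 (hlt.trans_le (SignType.le_one _))
  have huy : t ⬝ᵥ y ≤ u ⬝ᵥ y := by
    rw [← sub_nonneg, ← sub_dotProduct, ← sign_nonneg_iff]
    exact SignType.neg_one_lt_iff.1 ((SignType.neg_one_le _).trans_lt hlt)
  exact sum_lt_sum (fun s hs => hcast.monotone (hxy.sign_sub_le_sign_sub ht hux huy hs))
    ⟨t, ht, hcast hlt⟩

lemma exists_card_le_two_sameOrder_insert (S : Finset (ι → ℝ)) (u x : ι → ℝ) :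
    ∃ T ⊆ insert 0 S, #T ≤ 2 ∧ ∀ y, SameOrder S x y →
      (∀ t ∈ T, sign ((u - t) ⬝ᵥ x) = sign ((u - t) ⬝ᵥ y)) → SameOrder (insert u S) x y := by
  obtain ⟨T, hT, hTcard, hTmax⟩ := exists_subset_card_le_one_forall_le
    {s ∈ insert 0 S | s ⬝ᵥ x ≤ u ⬝ᵥ x} (· ⬝ᵥ x)
  obtain ⟨T', hT', hTcard', hTmax'⟩ := exists_subset_card_le_one_forall_le
    {s ∈ insert 0 S | u ⬝ᵥ x ≤ s ⬝ᵥ x} (· ⬝ᵥ -x)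
  refine ⟨T ∪ T', union_subset (hT.trans (filter_subset _ _)) (hT'.trans (filter_subset _ _)),
    (card_union_le _ _).trans (Nat.add_le_add hTcard hTcard'), fun y hxy hsign =>
      hxy.insert_of_forall fun s hs => ?_⟩
  rcases le_total (s ⬝ᵥ x) (u ⬝ᵥ x) with hsu | hus
  · obtain ⟨t, htT, hst⟩ := hTmax s (mem_filter.2 ⟨hs, hsu⟩)
    obtain ⟨ht, htu⟩ := mem_filter.1 (hT htT)
    exact hxy.sign_sub_eq_of_le hs ht hst htu (hsign t (mem_union_left _ htT))
  · obtain ⟨t, htT, hts⟩ := hTmax' s (mem_filter.2 ⟨hs, hus⟩)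
    obtain ⟨ht, hut⟩ := mem_filter.1 (hT' htT)
    have := hxy.neg.sign_sub_eq_of_le hs ht hts (by simpa using hut)
      (by simp only [dotProduct_neg, Left.sign_neg, hsign t (mem_union_right _ htT)])
    simpa only [dotProduct_neg, Left.sign_neg, neg_inj] using this

end Inference

namespace LinearDecisionTree

open SignType (sign)

variable {n : ℕ} {α : Type*} {H : Set (Fin n → ℝ)} {f : (Fin n → ℝ) → α}
  {X Y : Finset (Fin n → ℝ)} {S K : Finset (Fin n → ℝ)} {u : Fin n → ℝ} {D D' E d r : ℕ}

/-- Some comparison tree for `H` of depth at most `D` computes `f` on the points of `X`. -/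
def SolvableOn (H : Set (Fin n → ℝ)) (f : (Fin n → ℝ) → α) (X : Finset (Fin n → ℝ)) (D : ℕ) :
    Prop :=
  ∃ T : LinearDecisionTree n α, T.IsComparisonTree H ∧ T.depth ≤ D ∧ ∀ x ∈ X, T.eval x = f x

lemma SolvableOn.mono (hY : SolvableOn H f Y D) (hXY : X ⊆ Y) (hD : D ≤ D') :
    SolvableOn H f X D' := by
  obtain ⟨T, hT, hdepth, heval⟩ := hY
  exact ⟨T, hT, hdepth.trans hD, fun x hx => heval x (hXY hx)⟩

lemma isComparisonTree_leaf (a : α) : (leaf a : LinearDecisionTree n α).IsComparisonTree H := by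
  simp [IsComparisonTree, queries]

lemma solvableOn_of_forall_eq (hf : ∀ x ∈ X, ∀ y ∈ X, f x = f y) : SolvableOn H f X D := by
  rcases X.eq_empty_or_nonempty with rfl | ⟨x₀, hx₀⟩
  · exact ⟨leaf (f 0), isComparisonTree_leaf _, by simp [depth], by simp⟩
  · exact ⟨leaf (f x₀), isComparisonTree_leaf _, by simp [depth], fun x hx => hf x₀ hx₀ x hx⟩

lemma solvableOn_query {q : Fin n → ℝ} (hq : q ∈ H ∨ ∃ h' ∈ H, ∃ h'' ∈ H, q = h' - h'')
    (hparts : ∀ σ, SolvableOn H f {x ∈ X | sign (q ⬝ᵥ x) = σ} D) : SolvableOn H f X (D + 1) := by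
  choose T hT hdepth heval using hparts
  refine ⟨query q T, fun p hp => ?_, ?_, fun x hx => ?_⟩
  · simp only [queries, Set.singleton_union, Set.mem_insert_iff, Set.mem_iUnion] at hp
    rcases hp with rfl | ⟨σ, hσ⟩
    · exact hq
    · exact hT σ p hσ
  · exact Nat.succ_le_succ (Finset.sup_le fun σ _ => hdepth σ)
  · exact heval _ x (mem_filter.2 ⟨hx, rfl⟩)

lemma solvableOn_of_forall_mem_sign {Q : Finset (Fin n → ℝ)}
    (hQ : ∀ q ∈ Q, q ∈ H ∨ ∃ h' ∈ H, ∃ h'' ∈ H, q = h' - h'') {a : (Fin n → ℝ) → SignType}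
    (hne : ∀ q ∈ Q, ∀ σ ≠ a q, SolvableOn H f {x ∈ X | sign (q ⬝ᵥ x) = σ} D)
    (heq : SolvableOn H f {x ∈ X | ∀ q ∈ Q, sign (q ⬝ᵥ x) = a q} D) :
    SolvableOn H f X (D + #Q) := by
  induction Q using Finset.induction_on generalizing X with
  | empty => simpa using heq
  | insert q Q hq ih =>
    rw [forall_mem_insert] at hQ hne
    rw [card_insert_of_notMem hq, ← add_assoc]
    refine solvableOn_query hQ.1 fun σ => ?_
    by_cases hσ : σ = a q
    · refine ih hQ.2 (fun p hp τ hτ => ?_) ?_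
      · exact (hne.2 p hp τ hτ).mono (filter_subset_filter _ (filter_subset _ _)) le_rfl
      · rw [filter_filter]
        simpa only [forall_mem_insert, hσ] using heq
    · exact (hne.1 σ hσ).mono subset_rfl (Nat.le_add_right _ _)

lemma log_two_card_add_le {m : ℕ} (hY : Y.Nonempty) (hYX : 2 ^ m * #Y ≤ #X) :
    Nat.log 2 #Y + m ≤ Nat.log 2 #X := by
  refine Nat.le_log_of_pow_le one_lt_two ?_
  rw [pow_add, mul_comm]
  exact (Nat.mul_le_mul_left _ (Nat.pow_log_le_self 2 hY.card_ne_zero)).trans hYX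

open scoped Classical in
lemma solvableOn_add_two_of_insert (hu : u ∈ H) (hSH : ∀ s ∈ S, s ∈ H)
    (hX : ∀ x ∈ X, ∀ y ∈ X, SameOrder S x y)
    (hhalf : ∀ Y ⊆ X, 2 * #Y ≤ #X → SolvableOn H f Y D)
    (hinsert : ∀ Y ⊆ X, (∀ x ∈ Y, ∀ y ∈ Y, SameOrder (insert u S) x y) → SolvableOn H f Y D) :
    SolvableOn H f X (D + 2) := by
  rcases X.eq_empty_or_nonempty with rfl | hne
  · exact solvableOn_of_forall_eq (by simp)
  -- A monotone function of the position of `u` among the elements of `insert 0 S`.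
  let rank : (Fin n → ℝ) → ℤ := fun x => ∑ s ∈ insert 0 S, (sign ((u - s) ⬝ᵥ x) : ℤ)
  have hrank : ∀ x ∈ X, ∀ y ∈ X, ∀ t ∈ insert 0 S,
      sign ((u - t) ⬝ᵥ x) < sign ((u - t) ⬝ᵥ y) → rank x < rank y :=
    fun x hx y hy t ht => (hX x hx y hy).sum_sign_sub_lt_sum_sign_sub ht
  obtain ⟨x₀, hx₀, hlow, hhigh⟩ := exists_median hne rank
  obtain ⟨T, hTS, hTcard, hT⟩ := exists_card_le_two_sameOrder_insert S u x₀
  refine SolvableOn.mono (solvableOn_of_forall_mem_sign (Q := T.image (u - ·))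
    (a := fun q => sign (q ⬝ᵥ x₀)) (D := D) ?_ ?_ ?_) subset_rfl
    (Nat.add_le_add_left (card_image_le.trans hTcard) D)
  all_goals simp only [forall_mem_image]
  · intro t ht
    rcases mem_insert.1 (hTS ht) with rfl | htS
    · exact .inl (by simpa)
    · exact .inr ⟨u, hu, t, hSH t htS, rfl⟩
  · intro t ht σ hσ
    rcases hσ.lt_or_gt with hlt | hgt
    · refine hhalf _ (filter_subset _ _) (le_trans ?_ hlow)
      gcongr with x hx
      rintro rfl
      exact hrank x hx x₀ hx₀ t (hTS ht) hlt
    · refine hhalf _ (filter_subset _ _) (le_trans ?_ hhigh)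
      gcongr with x hx
      rintro rfl
      exact hrank x₀ hx₀ x hx t (hTS ht) hgt
  · have hsame : ∀ x ∈ {x ∈ X | ∀ t ∈ T, sign ((u - t) ⬝ᵥ x) = sign ((u - t) ⬝ᵥ x₀)},
        SameOrder (insert u S) x₀ x := fun x hx =>
      hT x (hX x₀ hx₀ x (mem_filter.1 hx).1) fun t ht => ((mem_filter.1 hx).2 t ht).symm
    exact hinsert _ (filter_subset _ _) fun x hx y hy => (hsame x hx).symm.trans (hsame y hy)

-- All but two of the queries are paid for by a halving of the set of candidate points.
open scoped Classical in
theorem solvableOn_of_insert (hu : u ∈ H) (hSH : ∀ s ∈ S, s ∈ H)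
    (hX : ∀ x ∈ X, ∀ y ∈ X, SameOrder S x y)
    (hinsert : ∀ Y ⊆ X, (∀ x ∈ Y, ∀ y ∈ Y, SameOrder (insert u S) x y) →
      SolvableOn H f Y (E + 2 * Nat.log 2 #Y)) :
    SolvableOn H f X (E + 2 + 2 * Nat.log 2 #X) := by
  induction X using Finset.strongInduction with
  | H X ih =>
  refine (solvableOn_add_two_of_insert (D := E + 2 * Nat.log 2 #X) hu hSH hX
    (fun Y hYX hhalf => ?_) fun Y hYX hY => ?_).mono subset_rfl (by omega)
  · rcases Y.eq_empty_or_nonempty with rfl | hne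
    · exact solvableOn_of_forall_eq (by simp)
    have hpos := hne.card_pos
    have hlog := log_two_card_add_le (m := 1) hne (by simpa using hhalf)
    exact (ih Y (hYX.ssubset_of_ne (by rintro rfl; omega))
      (fun x hx y hy => hX x (hYX hx) y (hYX hy))
      fun Z hZ => hinsert Z (hZ.trans hYX)).mono subset_rfl (by omega)
  · exact (hinsert Y hYX hY).mono subset_rfl (by gcongr)

/-- The elements of `K` whose sign is not constant on `X`: what remains to be found out when the
input is known to lie in `X`. -/
noncomputable def undetermined (K X : Finset (Fin n → ℝ)) : Finset (Fin n → ℝ) :=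
  {h ∈ K | ∃ x ∈ X, ∃ y ∈ X, sign (h ⬝ᵥ x) ≠ sign (h ⬝ᵥ y)}

lemma undetermined_subset_not_infers [DecidablePred fun u => ¬ Infers S x u]
    (hX : ∀ y ∈ X, SameOrder S x y) : undetermined K X ⊆ {u ∈ K | ¬ Infers S x u} := by
  intro u hu
  obtain ⟨huK, y, hy, z, hz, hyz⟩ := mem_filter.1 hu
  exact mem_filter.2 ⟨huK, fun hi => hyz ((hi y (hX y hy)).trans (hi z (hX z hz)).symm)⟩

open scoped Classical in
lemma exists_card_mul_sum_chainCount_le (hX : ∀ x ∈ X, ∀ y ∈ X, SameOrder S x y)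
    (hK : #K < 2 * #(undetermined K X)) (r : ℕ) :
    ∃ u ∈ K, #K * ∑ x ∈ X, chainCount (fun S u => ¬ Infers S x u) K r (insert u S) ≤
      2 * ∑ x ∈ X, chainCount (fun S u => ¬ Infers S x u) K (r + 1) S := by
  obtain ⟨h, hh⟩ := card_pos.1 (by omega : 0 < #(undetermined K X))
  obtain ⟨-, x₀, hx₀, -⟩ := mem_filter.1 hh
  have hU : ∀ x ∈ X, {u ∈ K | ¬ Infers S x u} = {u ∈ K | ¬ Infers S x₀ u} := fun x hx =>
    filter_congr fun u _ => not_congr ⟨.congr (hX x hx x₀ hx₀), .congr (hX x₀ hx₀ x hx)⟩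
  have hlt := hK.trans_le <|
    Nat.mul_le_mul_left 2 (card_le_card (undetermined_subset_not_infers (hX x₀ hx₀)))
  obtain ⟨u, hu, hsum⟩ := exists_mul_le_two_mul_sum hlt fun u =>
    ∑ x ∈ X, chainCount (fun S u => ¬ Infers S x u) K r (insert u S)
  refine ⟨u, (mem_filter.1 hu).1, hsum.trans_eq ?_⟩
  rw [sum_comm]
  exact congrArg _ (sum_congr rfl fun x hx => by simp only [chainCount, hU x hx])

lemma solvableOn_of_chainCount (hKH : ∀ h ∈ K, h ∈ H) (hSH : ∀ s ∈ S, s ∈ H)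
    (hX : ∀ x ∈ X, ∀ y ∈ X, SameOrder S x y)
    (hhalf : ∀ Y ⊆ X, 2 * #(undetermined K Y) ≤ #K → SolvableOn H f Y (E + 2 * Nat.log 2 #Y))
    (hfew : ∀ Y ⊆ X, #Y * #K ^ r ≤
        2 ^ r * ∑ x ∈ X, chainCount (fun S u => ¬ Infers S x u) K r S →
      SolvableOn H f Y (E + 2 * Nat.log 2 #Y)) :
    SolvableOn H f X (E + 2 * r + 2 * Nat.log 2 #X) := by
  induction r generalizing S X with
  | zero => exact hfew X subset_rfl (by simp [chainCount])
  | succ r ih =>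
    rcases le_or_gt (2 * #(undetermined K X)) #K with hK | hK
    · exact (hhalf X subset_rfl hK).mono subset_rfl (by omega)
    obtain ⟨u, hu, hsum⟩ := exists_card_mul_sum_chainCount_le hX hK r
    refine (solvableOn_of_insert (E := E + 2 * r) (hKH u hu) hSH hX fun Y hYX hY =>
      ih ?_ hY (fun Z hZ => hhalf Z (hZ.trans hYX)) fun Z hZ hcard =>
        hfew Z (hZ.trans hYX) ?_).mono subset_rfl (by omega)
    · simpa [hKH u hu] using hSH
    · calc #Z * #K ^ (r + 1) = #Z * #K ^ r * #K := by rw [pow_succ, mul_assoc]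
        _ ≤ 2 ^ r * (∑ x ∈ Y, chainCount (fun S u => ¬ Infers S x u) K r (insert u S)) * #K :=
          by gcongr
        _ ≤ 2 ^ r * (#K * ∑ x ∈ X, chainCount (fun S u => ¬ Infers S x u) K r (insert u S)) := by
          rw [mul_assoc, mul_comm #K]; gcongr
        _ ≤ 2 ^ r * (2 * ∑ x ∈ X, chainCount (fun S u => ¬ Infers S x u) K (r + 1) S) := by gcongr
        _ = 2 ^ (r + 1) * ∑ x ∈ X, chainCount (fun S u => ¬ Infers S x u) K (r + 1) S := by ring

open scoped Classical in
lemma solvableOn_of_halve (hd : ∀ S ⊆ K, ∀ x, #{h ∈ S | ¬ Infers (S.erase h) x h} ≤ d)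
    (hd₀ : 0 < d) (hKH : ∀ h ∈ K, h ∈ H)
    (hhalf : ∀ Y ⊆ X, 2 * #(undetermined K Y) ≤ #K → SolvableOn H f Y (E + 2 * Nat.log 2 #Y))
    (hfew : ∀ Y ⊆ X, 2 ^ (12 * d) * #Y ≤ #X → SolvableOn H f Y (E + 2 * Nat.log 2 #Y)) :
    SolvableOn H f X (E + 24 * d + 2 * Nat.log 2 #X) := by
  set m := 12 * d
  refine (solvableOn_of_chainCount (S := ∅) (r := m) hKH (by simp)
    (fun x _ y _ => by simp [SameOrder]) hhalf fun Y hYX hY => ?_).mono subset_rfl (by omega)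
  rcases K.eq_empty_or_nonempty with rfl | hK
  · exact hhalf Y hYX (by simp [undetermined])
  have hchain : ∀ x, chainCount (fun S u => ¬ Infers S x u) K m ∅ * 4 ^ m ≤ #K ^ m := fun x =>
    chainCount_empty_mul_four_pow_le (fun S u hu => not_not_intro (infers_of_mem hu))
      (fun S hS => by convert hd S hS x) hd₀
  refine hfew Y hYX (Nat.le_of_mul_le_mul_right (c := 2 ^ m * #K ^ m) ?_
    (Nat.mul_pos (by positivity) (pow_pos hK.card_pos m)))
  calc 2 ^ m * #Y * (2 ^ m * #K ^ m) = #Y * #K ^ m * 4 ^ m := by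
        rw [show 4 = 2 * 2 from rfl, mul_pow]; ring
    _ ≤ 2 ^ m * (∑ x ∈ X, chainCount (fun S u => ¬ Infers S x u) K m ∅) * 4 ^ m := by gcongr
    _ = 2 ^ m * ∑ x ∈ X, chainCount (fun S u => ¬ Infers S x u) K m ∅ * 4 ^ m := by
        rw [mul_assoc, sum_mul]
    _ ≤ 2 ^ m * ∑ _x ∈ X, #K ^ m := by gcongr; exact hchain _
    _ = #X * (2 ^ m * #K ^ m) := by rw [sum_const, smul_eq_mul]; ring

variable {F : Finset (Fin n → ℝ)} {j : ℕ}

lemma undetermined_subset_undetermined (hYX : Y ⊆ X) :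
    undetermined F Y ⊆ undetermined (undetermined F X) Y := fun h hh => by
  obtain ⟨hF, x, hx, y, hy, hxy⟩ := mem_filter.1 hh
  exact mem_filter.2 ⟨mem_filter.2 ⟨hF, x, hYX hx, y, hYX hy, hxy⟩, x, hx, y, hy, hxy⟩

open scoped Classical in
theorem solvableOn_of_card_undetermined_lt
    (hd : ∀ S ⊆ F, ∀ x, #{h ∈ S | ¬ Infers (S.erase h) x h} ≤ d) (hd₀ : 0 < d)
    (hf : ∀ x y, (∀ h ∈ F, sign (h ⬝ᵥ x) = sign (h ⬝ᵥ y)) → f x = f y)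
    (hj : #(undetermined F X) < 2 ^ j) :
    SolvableOn F f X (24 * d * j + 4 * Nat.log 2 #X) := by
  induction j generalizing X with
  | zero =>
    refine solvableOn_of_forall_eq fun x hx y hy => hf x y fun h hh => ?_
    by_contra hne
    have : h ∈ undetermined F X := mem_filter.2 ⟨hh, x, hx, y, hy, hne⟩
    rw [pow_zero, Nat.lt_one_iff, card_eq_zero] at hj
    simp [hj] at this
  | succ j ihj =>
    induction X using Finset.strongInduction with
    | H X ihX =>
    have hK : undetermined F X ⊆ F := filter_subset _ _
    refine (solvableOn_of_halve (K := undetermined F X) (E := 24 * d * j + 2 * Nat.log 2 #X)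
      (fun S hS => hd S (hS.trans hK)) hd₀ (fun h hh => hK hh) (fun Y hYX hhalf => ?_)
      fun Y hYX hfew => ?_).mono subset_rfl (by rw [mul_add]; omega)
    · have hsub := card_le_card (undetermined_subset_undetermined (F := F) hYX)
      have hlog := Nat.log_mono_right (b := 2) (card_le_card hYX)
      exact (ihj (by rw [pow_succ] at hj; omega)).mono subset_rfl (by omega)
    · rcases Y.eq_empty_or_nonempty with rfl | hne
      · exact solvableOn_of_forall_eq (by simp)
      have hlog := log_two_card_add_le hne hfew
      have hsub := card_le_card ((undetermined_subset_undetermined (F := F) hYX).trans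
        (filter_subset _ _))
      refine (ihX Y (hYX.ssubset_of_ne ?_) (hsub.trans_lt hj)).mono subset_rfl
        (by rw [mul_add]; omega)
      rintro rfl
      omega

lemma eval_congr {T : LinearDecisionTree n α} {x y : Fin n → ℝ}
    (hxy : ∀ q ∈ T.queries, sign (q ⬝ᵥ x) = sign (q ⬝ᵥ y)) : T.eval x = T.eval y := by
  induction T with
  | leaf a => rfl
  | query q child ih =>
    simp only [queries, Set.singleton_union, Set.forall_mem_insert, Set.mem_iUnion] at hxy
    simp only [eval, hxy.1]
    exact ih _ fun p hp => hxy.2 p ⟨_, hp⟩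

open scoped Classical Pointwise in
theorem exists_isComparisonTree_eval_eq
    (hd : ∀ S ⊆ F, ∀ x, #{h ∈ S | ¬ Infers (S.erase h) x h} ≤ d) (hd₀ : 0 < d)
    (hf : ∀ x y, (∀ h ∈ F, sign (h ⬝ᵥ x) = sign (h ⬝ᵥ y)) → f x = f y) (hj : #F < 2 ^ j) :
    ∃ T : LinearDecisionTree n α, T.IsComparisonTree F ∧
      T.depth ≤ 24 * d * j + 4 * (n * (2 * j + 2)) ∧ ∀ x, T.eval x = f x := by
  obtain ⟨X, hXcard, hX⟩ :=
    exists_sign_representatives (F ∪ (F - F)) (dotProductEquiv ℝ (Fin n))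
  obtain ⟨T, hT, hdepth, heval⟩ := solvableOn_of_card_undetermined_lt (X := X) hd hd₀ hf
    ((card_le_card (filter_subset _ _)).trans_lt hj)
  refine ⟨T, hT, hdepth.trans ?_, fun y => ?_⟩
  · have hQcard : 3 * #(F ∪ (F - F)) + 1 ≤ 2 ^ (2 * j + 2) := by
      calc 3 * #(F ∪ (F - F)) + 1 ≤ 3 * (#F + #F * #F) + 1 := by
            gcongr
            exact (card_union_le _ _).trans (Nat.add_le_add_left card_sub_le _)
        _ ≤ 4 * (#F + 1) ^ 2 := by nlinarith
        _ ≤ 4 * (2 ^ j) ^ 2 := by gcongr; exact hj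
        _ = 2 ^ (2 * j + 2) := by ring
    have hXcard' : #X ≤ 2 ^ (n * (2 * j + 2)) := by
      rw [finrank_fin_fun] at hXcard
      calc #X ≤ (3 * #(F ∪ (F - F)) + 1) ^ n := hXcard
        _ ≤ (2 ^ (2 * j + 2)) ^ n := by gcongr
        _ = 2 ^ (n * (2 * j + 2)) := by rw [← pow_mul, mul_comm]
    gcongr
    exact (Nat.log_mono_right hXcard').trans_eq (Nat.log_pow one_lt_two _)
  · obtain ⟨x, hx, hxy⟩ := hX y
    simp only [dotProductEquiv_apply_apply] at hxy
    have hQ : ∀ q ∈ T.queries, q ∈ F ∪ (F - F) := fun q hq => by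
      rcases hT q hq with hqF | ⟨g, hg, h, hh, rfl⟩
      · exact mem_union_left _ hqF
      · exact mem_union_right _ (sub_mem_sub hg hh)
    rw [eval_congr fun q hq => (hxy q (hQ q hq)).symm, heval x hx]
    exact hf x y fun h hh => hxy h (mem_union_left _ hh)

end LinearDecisionTree

section WeightVectors

variable {n k : ℕ} {h q : Fin n → ℝ}

lemma mem_weightVectors_iff :
    h ∈ weightVectors n k ↔
      ∃ I : Finset (Fin n), #I = k ∧ (fun i => if i ∈ I then 1 else 0) = h := by
  constructor
  · rintro ⟨h01, hcard⟩
    refine ⟨univ.filter fun i => h i ≠ 0, hcard, funext fun i => ?_⟩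
    rcases h01 i with hi | hi <;> simp [hi]
  · rintro ⟨I, rfl, rfl⟩
    exact ⟨fun i => (ite_eq_or_eq _ _ _).symm, by simp [hammingNorm]⟩

open scoped Classical in
lemma exists_coe_eq_weightVectors (n k : ℕ) :
    ∃ F : Finset (Fin n → ℝ), (F : Set (Fin n → ℝ)) = weightVectors n k ∧ #F ≤ n ^ k := by
  refine ⟨(univ.powersetCard k).image fun (I : Finset (Fin n)) i => if i ∈ I then 1 else 0,
    ?_, ?_⟩
  · ext h
    simp [mem_weightVectors_iff]
  · calc _ ≤ #((univ : Finset (Fin n)).powersetCard k) := card_image_le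
      _ = n.choose k := by rw [card_powersetCard, card_fin]
      _ ≤ n ^ k := n.choose_le_pow k

lemma hasKSum_iff_exists_pointLocation_eq_zero (x : Fin n → ℝ) :
    HasKSum k x ↔ ∃ h, pointLocation (weightVectors n k) x h = 0 := by
  simp [HasKSum, pointLocation, mem_weightVectors_iff, dotProduct, sign_eq_zero_iff]

lemma hasBoundedIntDiffs_weightVectors : HasBoundedIntDiffs 1 (weightVectors n k) := by
  rintro g ⟨hg, -⟩ h ⟨hh, -⟩ j
  rcases hg j with hgj | hgj <;> rcases hh j with hhj | hhj
  · exact ⟨0, by simp, by simp [hgj, hhj]⟩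
  · exact ⟨-1, by simp, by simp [hgj, hhj]⟩
  · exact ⟨1, by simp, by simp [hgj, hhj]⟩
  · exact ⟨0, by simp, by simp [hgj, hhj]⟩

variable {α : Type*} {T : LinearDecisionTree n α}

lemma LinearDecisionTree.IsComparisonTree.isSparse_two_mul
    (hT : T.IsComparisonTree (weightVectors n k)) : T.IsSparse (2 * k) := by
  intro q hq
  rcases hT q hq with hqk | ⟨g, hg, h, hh, rfl⟩
  · exact hqk.2.trans_le (Nat.le_mul_of_pos_left k two_pos)
  · calc hammingNorm (g - h) = hammingDist h g := by
          rw [hammingDist_eq_hammingNorm, sub_eq_neg_add]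
      _ ≤ hammingDist h 0 + hammingDist 0 g := hammingDist_triangle h 0 g
      _ = 2 * k := by rw [hammingDist_zero_right, hammingDist_zero_left, hg.2, hh.2, two_mul]

lemma LinearDecisionTree.IsComparisonTree.apply_eq_neg_one_or_zero_or_one
    (hT : T.IsComparisonTree (weightVectors n k)) (hq : q ∈ T.queries) (i : Fin n) :
    q i = -1 ∨ q i = 0 ∨ q i = 1 := by
  rcases hT q hq with hqk | ⟨g, hg, h, hh, rfl⟩
  · exact .inr (hqk.1 i)
  · rcases hg.1 i with hgi | hgi <;> rcases hh.1 i with hhi | hhi <;> simp [hgi, hhi]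

end WeightVectors

section Depth

variable {n : ℕ}

lemma natLog_add_one_le_three_mul_log (hn : 2 ≤ n) : (Nat.log 2 n + 1 : ℝ) ≤ 3 * Real.log n := by
  have hlog : (Nat.log 2 n : ℝ) * Real.log 2 ≤ Real.log n := by
    rw [← Real.log_pow]
    exact Real.log_le_log (by positivity) (by exact_mod_cast Nat.pow_log_le_self 2 (by omega))
  have hone : (1 : ℝ) ≤ Nat.log 2 n := by exact_mod_cast Nat.log_pos one_lt_two hn
  nlinarith [Real.log_two_gt_d9]

lemma two_mul_pow_lt_two_pow {L : ℕ} (hn : 0 < n) (hL : 2 ≤ L) (hnL : n < 2 ^ L) :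
    (2 * (4 * n * L)) ^ n < 2 ^ (4 * n * L) := by
  have hbase : 2 * (4 * n * L) < 2 ^ (2 * L + 3) := by
    calc 2 * (4 * n * L) = 8 * (n * L) := by ring
      _ < 8 * (2 ^ L * 2 ^ L) := by
        gcongr
        exact L.lt_two_pow_self
      _ = 2 ^ (2 * L + 3) := by ring
  calc (2 * (4 * n * L)) ^ n < (2 ^ (2 * L + 3)) ^ n := Nat.pow_lt_pow_left hbase hn.ne'
    _ = 2 ^ ((2 * L + 3) * n) := by rw [← pow_mul]
    _ ≤ 2 ^ (4 * n * L) := by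
      refine Nat.pow_le_pow_right two_pos ?_
      calc (2 * L + 3) * n ≤ (4 * L) * n := Nat.mul_le_mul_right _ (by omega)
        _ = 4 * n * L := by ring

open LinearDecisionTree in
lemma exists_isComparisonTree_weightVectors_zero (n : ℕ) :
    ∃ T : LinearDecisionTree n (weightVectors n 0 → SignType),
      T.IsComparisonTree (weightVectors n 0) ∧ T.depth = 0 ∧
      ∀ x, T.eval x = pointLocation (weightVectors n 0) x := by
  refine ⟨leaf 0, isComparisonTree_leaf 0, rfl, fun x => funext fun ⟨h, hh⟩ => ?_⟩
  have h_zero : h = 0 := hammingNorm_eq_zero.1 hh.2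
  simp [eval, pointLocation, h_zero]

open LinearDecisionTree in
lemma exists_isComparisonTree_weightVectors (hn : 2 ≤ n) {k : ℕ} (hk : 0 < k) :
    ∃ T : LinearDecisionTree n (weightVectors n k → SignType),
      T.IsComparisonTree (weightVectors n k) ∧
      T.depth ≤ 294 * (k * n * (Nat.log 2 n + 1) ^ 2) ∧
      ∀ x, T.eval x = pointLocation (weightVectors n k) x := by
  classical
  obtain ⟨F, hF, hFcard⟩ := exists_coe_eq_weightVectors n k
  set L := Nat.log 2 n + 1
  have hL : 2 ≤ L := Nat.succ_le_succ (Nat.log_pos one_lt_two hn)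
  have hnL : n < 2 ^ L := Nat.lt_pow_succ_log_self one_lt_two n
  have hd₀ : 0 < 4 * n * L := by positivity
  have hd : ∀ S ⊆ F, ∀ x, #{h ∈ S | ¬ Infers (S.erase h) x h} ≤ 3 * (4 * n * L) := by
    intro S hS x
    have hSk : (S : Set (Fin n → ℝ)) ⊆ weightVectors n k := hF ▸ coe_subset.2 hS
    refine card_filter_not_infers_le one_pos hd₀ ?_
      (fun g hg h hh => hasBoundedIntDiffs_weightVectors g (hSk hg) h (hSk hh)) x
    simpa using two_mul_pow_lt_two_pow (by omega) hL hnL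
  have hf : ∀ x y, (∀ h ∈ F, SignType.sign (h ⬝ᵥ x) = SignType.sign (h ⬝ᵥ y)) →
      pointLocation (weightVectors n k) x = pointLocation (weightVectors n k) y := by
    intro x y hxy
    funext h
    rw [pointLocation, pointLocation, dotProduct_comm x, dotProduct_comm y]
    exact hxy h (by simp [← mem_coe, hF])
  have hj : #F < 2 ^ (L * k) := by
    rw [pow_mul]
    exact hFcard.trans_lt (Nat.pow_lt_pow_left hnL hk.ne')
  obtain ⟨T, hT, hdepth, heval⟩ := exists_isComparisonTree_eval_eq hd (by positivity) hf hj
  rw [hF] at hT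
  refine ⟨T, hT, hdepth.trans ?_, heval⟩
  calc 24 * (3 * (4 * n * L)) * (L * k) + 4 * (n * (2 * (L * k) + 2))
      = 288 * (k * n * L ^ 2) + 4 * (k * n * L) * 2 + 2 * n * 2 * 2 := by ring
    _ ≤ 288 * (k * n * L ^ 2) + 4 * (k * n * L) * L + 2 * (k * n) * L * L := by
      gcongr
      exact Nat.le_mul_of_pos_left n hk
    _ = 294 * (k * n * L ^ 2) := by ring

lemma exists_isComparisonTree_weightVectors_depth_le (hn : 2 ≤ n) (k : ℕ) :
    ∃ T : LinearDecisionTree n (weightVectors n k → SignType),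
      T.IsComparisonTree (weightVectors n k) ∧
      (T.depth : ℝ) ≤ 2646 * k * n * (Real.log n) ^ 2 ∧
      ∀ x, T.eval x = pointLocation (weightVectors n k) x := by
  rcases k.eq_zero_or_pos with rfl | hk
  · obtain ⟨T, hT, hdepth, heval⟩ := exists_isComparisonTree_weightVectors_zero n
    exact ⟨T, hT, by simp [hdepth], heval⟩
  · obtain ⟨T, hT, hdepth, heval⟩ := exists_isComparisonTree_weightVectors hn hk
    refine ⟨T, hT, ?_, heval⟩
    calc (T.depth : ℝ) ≤ 294 * (k * n * (Nat.log 2 n + 1) ^ 2) := by exact_mod_cast hdepth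
      _ ≤ 294 * (k * n * (3 * Real.log n) ^ 2) := by
        gcongr
        exact natLog_add_one_le_three_mul_log hn
      _ = 2646 * k * n * (Real.log n) ^ 2 := by ring

end Depth

theorem mainTheorem5 :
    ∃ C : ℝ, 0 < C ∧ ∀ n k : ℕ, 2 ≤ n →
      ∃ T : LinearDecisionTree n (weightVectors n k → SignType),
        T.IsComparisonTree (weightVectors n k) ∧
        (T.depth : ℝ) ≤ C * k * n * (Real.log n) ^ 2 ∧
        (∀ x : Fin n → ℝ, T.eval x = pointLocation (weightVectors n k) x) ∧
        (∀ x : Fin n → ℝ, HasKSum k x ↔ ∃ h, T.eval x h = 0) ∧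
        T.IsSparse (2 * k) ∧
        (∀ q ∈ T.queries, ∀ i, q i = -1 ∨ q i = 0 ∨ q i = 1) := by
  refine ⟨2646, by norm_num, fun n k hn => ?_⟩
  obtain ⟨T, hT, hdepth, heval⟩ := exists_isComparisonTree_weightVectors_depth_le hn k
  refine ⟨T, hT, hdepth, heval, fun x => ?_, hT.isSparse_two_mul, fun q hq i =>
    hT.apply_eq_neg_one_or_zero_or_one hq i⟩
  rw [heval x]
  exact hasKSum_iff_exists_pointLocation_eq_zero x
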